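/- A convex body is a nonempty compact convex subset of $\mathbb{R}^n$ with more than one point; its interior may be empty. For sets $A,B\subset\mathbb{R}^n$ write $A\subset_t B$ if $A\subset c+B$ for some $c\in\mathbb{R}^n$. For convex bodies $K,C\subset\mathbb{R}^n$ define, with values in $[0,\infty]$, the circumradius $R(K,C)=\inf\{\rho>0: K\subset_t\rho C\}$ (with $\inf\emptyset=\infty$; the same definition is used when $K$ is a point), the inradius $r(K,C)=\sup\{\rho\ge 0:\rho C\subset_t K\}$, the diameter $D(K,C)=\sup_{x,y\in K}2R([x,y],C)$, where $[x,y]$ is the segment with endpoints $x$ and $y$, and the Minkowski asymmetry $s(C)=R(-C,C)$. A point $c\in\mathbb{R}^n$ is a Minkowski center of $C$ if $-(C-c)\subset s(C)(C-c)$. If $R(K,C)<\infty$, then $K$ is called Minkowski concentric with respect to $C$ if there are a Minkowski center $c$ of $C$ and a point $t\in\mathbb{R}^n$ such that $r(K,C)(C-c)\subset K-t\subset R(K,C)(C-c)$. **Theorem 1.** Let $K$ and $C$ be convex bodies in $\mathbb{R}^n$. Then both of the following inequality chains hold: $$(1+s(K))\,r(K,-C)\le r(K,-C)+R(K,C)\le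 s(C)\,r(K,C)+R(K,C)\le\tfrac12(1+s(C))\,D(K,C)$$ and $$(1+s(K))\,r(K,-C)\le r(K,-C)+R(K,C)\le\frac{1+s(K)}{s(K)}\,R(K,C)\le\tfrac12(1+s(C))\,D(K,C).$$ Moreover, if $R(K,C)<\infty$ and equality holds in the generalized concentricity inequality $s(C)\,r(K,C)+R(K,C)\le\tfrac12(1+s(C))\,D(K,C)$, then $K$ is Minkowski concentric with respect to $C$. -/

import Mathlib

open scoped Pointwise ENNReal

noncomputable section

namespace MinkowskiRadii

variable {E : Type*} [AddCommGroup E] [Module ℝ E]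

/-- `K ⊂ₜ C`: the set `K` is contained in some translate `c + C` of `C`. -/
def SubsetTranslate (K C : Set E) : Prop :=
  ∃ c : E, K ⊆ c +ᵥ C

/-- The circumradius `R(K, C) = inf {ρ > 0 : K ⊂ₜ ρ C}`, with value `∞` if there is no such `ρ`. -/
def circumradius (K C : Set E) : ℝ≥0∞ :=
  ⨅ (ρ : ℝ) (_ : 0 < ρ) (_ : SubsetTranslate K (ρ • C)), ENNReal.ofReal ρ

/-- The inradius `r(K, C) = sup {ρ ≥ 0 : ρ C ⊂ₜ K}`. -/
def inradius (K C : Set E) : ℝ≥0∞ :=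
  ⨆ (ρ : ℝ) (_ : 0 ≤ ρ) (_ : SubsetTranslate (ρ • C) K), ENNReal.ofReal ρ

/-- The length `2 R([x, y], C)` of the segment `[x, y]` with respect to `C`. -/
def segmentLength (x y : E) (C : Set E) : ℝ≥0∞ :=
  2 * circumradius (segment ℝ x y) C

/-- The diameter `D(K, C)`: the supremum of the lengths with respect to `C` of the segments with
both endpoints in `K`. -/
def diameter (K C : Set E) : ℝ≥0∞ :=
  ⨆ (x ∈ K) (y ∈ K), segmentLength x y C

/-- The Minkowski asymmetry `s(C) = R(-C, C)`. -/
def asymmetry (C : Set E) : ℝ≥0∞ :=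
  circumradius (-C) C

/-- `c` is a Minkowski center of `C`: `-(C - c) ⊆ s(C) (C - c)` (and `s(C)` is finite). -/
def IsMinkowskiCenter (C : Set E) (c : E) : Prop :=
  asymmetry C ≠ ∞ ∧ -((-c) +ᵥ C) ⊆ (asymmetry C).toReal • ((-c) +ᵥ C)

/-- `K` is Minkowski concentric with respect to `C`: both radii are finite, and for some Minkowski
center `c` of `C` and some `t` one has `r(K, C) (C - c) ⊆ K - t ⊆ R(K, C) (C - c)`. -/
def IsMinkowskiConcentric (K C : Set E) : Prop :=
  inradius K C ≠ ∞ ∧ circumradius K C ≠ ∞ ∧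
    ∃ c t : E, IsMinkowskiCenter C c ∧
      (inradius K C).toReal • ((-c) +ᵥ C) ⊆ (-t) +ᵥ K ∧
      (-t) +ᵥ K ⊆ (circumradius K C).toReal • ((-c) +ᵥ C)

end MinkowskiRadii

end

open MinkowskiRadii

namespace MinkowskiRadii

/-! All radii are attained, so the claims become inclusions up to translation. Write s = s(C), r =
r(K,C), R = R(K,C), D(K,C) = 2δ; finite D means K - K ⊆ δ(C - C). For generalized concentricity,
center C so that -C ⊆ sC and let t + rC ⊆ K. Then (K - t) + r(-C) ⊆ δC + δ(-C); cancelling r(-C)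
gives K - t ⊆ δC + (δ - r)(-C) ⊆ (δ + (δ - r)s)C (`sub_mem_smul_of_concentric`). Hence R ≤ δ + (δ -
r)s, and under equality this inclusion together with t + rC ⊆ K is concentricity. The last bound of
the second chain compares K with K - K and C - C with C (`subsetTranslate_smul_of_sub`); the other
bounds compose inclusions between -C, C, K and -K. -/

theorem nontrivial_neg {G : Type*} [AddGroup G] {A : Set G} (hA : A.Nontrivial) : (-A).Nontrivial := by
  rw [← Set.image_neg_eq_neg]
  exact hA.image neg_injective

/-! ### Inclusions up to translation. -/

section Module

variable {E : Type*} [AddCommGroup E] [Module ℝ E]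

theorem subsetTranslate_smul_iff {A C : Set E} {ρ : ℝ} :
    SubsetTranslate A (ρ • C) ↔ ∃ c : E, ∀ x ∈ A, ∃ y ∈ C, x = c + ρ • y := by
  refine exists_congr fun c => forall₂_congr fun x _ => ?_
  simp only [Set.mem_vadd_set, Set.mem_smul_set, vadd_eq_add]
  constructor
  · rintro ⟨_, ⟨y, hy, rfl⟩, rfl⟩
    exact ⟨y, hy, rfl⟩
  · rintro ⟨y, hy, rfl⟩
    exact ⟨_, ⟨y, hy, rfl⟩, rfl⟩

theorem smul_subsetTranslate_iff {C K : Set E} {ρ : ℝ} :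
    SubsetTranslate (ρ • C) K ↔ ∃ c : E, ∀ y ∈ C, c + ρ • y ∈ K := by
  constructor
  · rintro ⟨c, hc⟩
    refine ⟨-c, fun y hy => ?_⟩
    simpa [Set.mem_vadd_set_iff_neg_vadd_mem] using hc (Set.smul_mem_smul_set hy)
  · rintro ⟨c, hc⟩
    refine ⟨-c, ?_⟩
    rintro _ ⟨y, hy, rfl⟩
    simpa [Set.mem_vadd_set_iff_neg_vadd_mem] using hc y hy

theorem circumradius_le {K C : Set E} {ρ : ℝ} (hρ : 0 < ρ) (h : SubsetTranslate K (ρ • C)) :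
    circumradius K C ≤ ENNReal.ofReal ρ :=
  iInf_le_of_le ρ (iInf₂_le hρ h)

theorem le_inradius {K C : Set E} {ρ : ℝ} (hρ : 0 ≤ ρ) (h : SubsetTranslate (ρ • C) K) :
    ENNReal.ofReal ρ ≤ inradius K C :=
  le_iSup_of_le ρ (le_iSup₂ (f := fun _ _ => ENNReal.ofReal ρ) hρ h)

theorem pos_of_subsetTranslate_smul {K C : Set E} (hK : K.Nontrivial) {ρ : ℝ} (hρ : 0 ≤ ρ)
    (h : SubsetTranslate K (ρ • C)) : 0 < ρ := by
  obtain ⟨c, hc⟩ := subsetTranslate_smul_iff.1 h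
  refine hρ.lt_of_ne ?_
  rintro rfl
  obtain ⟨x, hx, y, hy, hxy⟩ := hK
  obtain ⟨_, -, h1⟩ := hc x hx
  obtain ⟨_, -, h2⟩ := hc y hy
  exact hxy (by simp_all)

/-- Differences of points of a convex set can be rescaled by larger factors. -/
theorem exists_smul_sub_eq_of_le {C : Set E} (hC : Convex ℝ C) {ρ δ : ℝ} (hρ : 0 ≤ ρ)
    (hρδ : ρ ≤ δ) {a b : E} (ha : a ∈ C) (hb : b ∈ C) :
    ∃ a' ∈ C, ρ • (a - b) = δ • (a' - b) := by
  rcases hρ.eq_or_lt with rfl | hpos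
  · exact ⟨b, hb, by simp⟩
  have hδ : 0 < δ := hpos.trans_le hρδ
  refine ⟨b + (ρ / δ) • (a - b),
    hC.add_smul_sub_mem hb ha ⟨by positivity, (div_le_one hδ).2 hρδ⟩, ?_⟩
  rw [add_sub_cancel_left, smul_smul, mul_div_cancel₀ _ hδ.ne']

theorem exists_center {C : Set E} {s : ℝ} (hs : 0 ≤ s) (h : SubsetTranslate (-C) (s • C)) :
    ∃ c : E, -((-c) +ᵥ C) ⊆ s • ((-c) +ᵥ C) := by
  obtain ⟨x, hx⟩ := subsetTranslate_smul_iff.1 h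
  have h1 : (1 + s) ≠ 0 := by positivity
  -- From -C ⊆ x + sC, the center c must solve x + c = -s c.
  refine ⟨-(1 + s)⁻¹ • x, ?_⟩
  intro z hz
  rw [Set.mem_neg, Set.mem_vadd_set] at hz
  obtain ⟨a, ha, haz⟩ := hz
  obtain ⟨y, hy, hay⟩ := hx (-a) (by simpa using ha)
  refine ⟨_, ⟨y, hy, rfl⟩, ?_⟩
  have hz : z = -a - (1 + s)⁻¹ • x := by
    rw [← neg_neg z, ← haz]
    simp only [vadd_eq_add, neg_smul]
    abel
  rw [hz, hay]
  have : x = (1 + s)⁻¹ • x + s • (1 + s)⁻¹ • x := by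
    rw [smul_smul, ← add_smul, show (1 + s)⁻¹ + s * (1 + s)⁻¹ = 1 by field_simp, one_smul]
  simp only [vadd_eq_add, neg_smul, neg_neg, smul_add]
  nth_rewrite 2 [this]
  abel

end Module

/-! ### Attained radii, finite asymmetry, cancellation. -/

section Normed

variable {E : Type*} [NormedAddCommGroup E] [NormedSpace ℝ E]

theorem isCompact_graph_smul {C : Set E} (hC : IsCompact C) (M : ℝ) :
    IsCompact ((fun p : ℝ × E => (p.1, p.1 • p.2)) '' (Set.Icc 0 M ×ˢ C)) :=
  (isCompact_Icc.prod hC).image (by fun_prop)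

theorem exists_circumradius_eq {K C : Set E} (hK : K.Nonempty) (hC : IsCompact C)
    (hR : circumradius K C ≠ ∞) :
    ∃ ρ : ℝ, 0 ≤ ρ ∧ circumradius K C = ENNReal.ofReal ρ ∧ SubsetTranslate K (ρ • C) := by
  obtain ⟨x₀, hx₀⟩ := hK
  obtain ⟨M, hM, hMK⟩ : ∃ M : ℝ, 0 < M ∧ SubsetTranslate K (M • C) := by
    by_contra! h
    exact hR (by simpa [circumradius] using h)
  set G := (fun p : ℝ × E => (p.1, p.1 • p.2)) '' (Set.Icc 0 M ×ˢ C) with hG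
  have hGc : IsCompact G := isCompact_graph_smul hC M
  -- Membership in the compact set `G` encodes x ∈ c + ρC as a closed condition on (ρ, c), although
  -- ρC varies with ρ.
  set S : Set (ℝ × E) := {p | ∀ x ∈ K, (p.1, x - p.2) ∈ G} with hS
  have hSmem : ∀ p : ℝ × E, p ∈ S ↔
      (0 ≤ p.1 ∧ p.1 ≤ M) ∧ ∀ x ∈ K, ∃ y ∈ C, x = p.2 + p.1 • y := by
    rintro ⟨ρ, c⟩
    constructor
    · intro h
      constructor
      · obtain ⟨⟨a, b⟩, ⟨h1, -⟩, h2⟩ := h x₀ hx₀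
        simp only [Prod.mk.injEq] at h2
        exact h2.1 ▸ h1
      · intro x hx
        obtain ⟨⟨a, b⟩, ⟨-, h1⟩, h2⟩ := h x hx
        simp only [Prod.mk.injEq] at h2
        obtain ⟨rfl, h3⟩ := h2
        exact ⟨b, h1, by simp [h3]⟩
    · rintro ⟨h1, h2⟩ x hx
      obtain ⟨y, hy, hxy⟩ := h2 x hx
      refine ⟨(ρ, y), ⟨h1, hy⟩, ?_⟩
      simp only at hxy
      simp [hxy]
  have hSclosed : IsClosed S := by
    simp only [hS, Set.ofPred_forall]
    refine isClosed_biInter fun x _ => hGc.isClosed.preimage (by fun_prop)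
  have hSc : IsCompact S := by
    refine (hGc.image (f := fun p : ℝ × E => (p.1, x₀ - p.2)) (by fun_prop)).of_isClosed_subset
      hSclosed ?_
    rintro ⟨ρ, c⟩ h
    exact ⟨_, h x₀ hx₀, by simp⟩
  have hSne : S.Nonempty := by
    obtain ⟨c, hc⟩ := subsetTranslate_smul_iff.1 hMK
    exact ⟨(M, c), (hSmem _).2 ⟨⟨hM.le, le_rfl⟩, hc⟩⟩
  obtain ⟨⟨ρ, c⟩, hp, hmin⟩ := hSc.exists_isMinOn hSne (f := Prod.fst) continuous_fst.continuousOn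
  have hp' := (hSmem _).1 hp
  have hle : ∀ ρ' : ℝ, 0 < ρ' → SubsetTranslate K (ρ' • C) → ρ ≤ ρ' := by
    intro ρ' h1 h2
    rcases le_total ρ' M with h3 | h3
    · obtain ⟨c', hc'⟩ := subsetTranslate_smul_iff.1 h2
      exact hmin ((hSmem (ρ', c')).2 ⟨⟨h1.le, h3⟩, hc'⟩)
    · exact hp'.1.2.trans h3
  have hlow : ENNReal.ofReal ρ ≤ circumradius K C :=
    le_iInf fun ρ' => le_iInf₂ fun h1 h2 => ENNReal.ofReal_le_ofReal (hle ρ' h1 h2)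
  have hsub : SubsetTranslate K (ρ • C) := subsetTranslate_smul_iff.2 ⟨c, hp'.2⟩
  refine ⟨ρ, hp'.1.1, le_antisymm ?_ hlow, hsub⟩
  -- The infimum runs over ρ > 0 only. If the minimum is 0, then K is a point and every ε > 0 is
  -- admissible.
  rcases hp'.1.1.eq_or_lt with h0 | h0
  · simp only at h0
    subst h0
    refine ENNReal.le_of_forall_pos_le_add fun ε hε _ => ?_
    obtain ⟨y, hy, -⟩ := hp'.2 x₀ hx₀
    have : SubsetTranslate K ((ε : ℝ) • C) := by
      refine subsetTranslate_smul_iff.2 ⟨c - (ε : ℝ) • y, fun x hx => ⟨y, hy, ?_⟩⟩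
      obtain ⟨z, -, hz⟩ := hp'.2 x hx
      simpa using hz
    simpa using circumradius_le (by exact_mod_cast hε) this
  · exact circumradius_le h0 hsub

/-- Compare diameters: ρ diam C ≤ δ diam C with diam C > 0. -/
theorem le_of_smul_sub_smul_mem {C : Set E} (hC : Bornology.IsBounded C) (hne : C.Nontrivial)
    {ρ δ : ℝ} (hδ : 0 ≤ δ)
    (h : ∀ a ∈ C, ∀ b ∈ C, ∃ x ∈ C, ∃ y ∈ C, ρ • (a - b) = δ • (x - y)) : ρ ≤ δ := by
  have hpos : 0 < Metric.diam C := Metric.diam_pos hne hC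
  rcases le_or_gt ρ 0 with hρ | hρ
  · exact hρ.trans hδ
  have key : Metric.diam C ≤ δ / ρ * Metric.diam C := by
    refine Metric.diam_le_of_forall_dist_le (by positivity) fun a ha b hb => ?_
    obtain ⟨x, hx, y, hy, hxy⟩ := h a ha b hb
    have h1 : ρ * dist a b = δ * dist x y := by
      have := congrArg norm hxy
      rwa [norm_smul, norm_smul, Real.norm_of_nonneg hρ.le, Real.norm_of_nonneg hδ,
        ← dist_eq_norm, ← dist_eq_norm] at this
    have h2 : dist x y ≤ Metric.diam C := Metric.dist_le_diam_of_mem hC hx hy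
    rw [div_mul_eq_mul_div, le_div_iff₀ hρ, mul_comm, h1]
    gcongr
  have : 1 ≤ δ / ρ := by
    by_contra! hlt
    nlinarith
  rwa [one_le_div hρ] at this

theorem exists_inradius_eq {K C : Set E} (hK : IsCompact K) (hKne : K.Nonempty)
    (hC : Bornology.IsBounded C) (hCne : C.Nontrivial) :
    ∃ ρ : ℝ, 0 ≤ ρ ∧ inradius K C = ENNReal.ofReal ρ ∧ SubsetTranslate (ρ • C) K := by
  have hpos : 0 < Metric.diam C := Metric.diam_pos hCne hC
  obtain ⟨y₀, hy₀⟩ := hCne.nonempty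
  obtain ⟨k₀, hk₀⟩ := hKne
  set M := Metric.diam K / Metric.diam C
  have hM : ∀ ρ : ℝ, 0 ≤ ρ → ∀ c : E, (∀ y ∈ C, c + ρ • y ∈ K) → ρ ≤ M := by
    intro ρ hρ c hc
    rw [le_div_iff₀ hpos]
    rcases hρ.eq_or_lt with rfl | hρ
    · simpa using Metric.diam_nonneg
    rw [mul_comm, ← le_div_iff₀ hρ]
    refine Metric.diam_le_of_forall_dist_le (by positivity) fun a ha b hb => ?_
    have := Metric.dist_le_diam_of_mem hK.isBounded (hc a ha) (hc b hb)
    rw [dist_add_left, dist_smul₀, Real.norm_of_nonneg hρ.le] at this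
    rwa [le_div_iff₀ hρ, mul_comm]
  set S : Set (ℝ × E) := {p | 0 ≤ p.1 ∧ ∀ y ∈ C, p.2 + p.1 • y ∈ K} with hS
  have hSclosed : IsClosed S := by
    have : S = {p : ℝ × E | 0 ≤ p.1} ∩ ⋂ y ∈ C, {p : ℝ × E | p.2 + p.1 • y ∈ K} := by
      ext p
      simp [hS]
    rw [this]
    refine (isClosed_le continuous_const continuous_fst).inter
      (isClosed_biInter fun y _ => hK.isClosed.preimage (by fun_prop))
  have hSc : IsCompact S := by
    refine (((isCompact_Icc (a := (0 : ℝ)) (b := M)).prod hK).image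
      (f := fun p : ℝ × E => (p.1, p.2 - p.1 • y₀)) (by fun_prop)).of_isClosed_subset hSclosed ?_
    rintro ⟨ρ, c⟩ h
    exact ⟨(ρ, c + ρ • y₀), ⟨⟨h.1, hM ρ h.1 c h.2⟩, h.2 y₀ hy₀⟩, by simp⟩
  have hSne : S.Nonempty := ⟨(0, k₀), le_rfl, fun y _ => by simpa using hk₀⟩
  obtain ⟨⟨ρ, c⟩, hp, hmax⟩ := hSc.exists_isMaxOn hSne (f := Prod.fst) continuous_fst.continuousOn
  have hsub : SubsetTranslate (ρ • C) K := smul_subsetTranslate_iff.2 ⟨c, hp.2⟩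
  refine ⟨ρ, hp.1, le_antisymm ?_ (le_inradius hp.1 hsub), hsub⟩
  refine iSup_le fun ρ' => iSup₂_le fun h1 h2 => ENNReal.ofReal_le_ofReal ?_
  obtain ⟨c', hc'⟩ := smul_subsetTranslate_iff.1 h2
  exact hmax (show (ρ', c') ∈ S from ⟨h1, hc'⟩)

/-- C may have empty interior, so a ball about a relative interior point is taken in the affine
span; a small reflected copy of C fits inside it. -/
theorem asymmetry_ne_top [FiniteDimensional ℝ E] {C : Set E} (hconv : Convex ℝ C)
    (hC : Bornology.IsBounded C) (hne : C.Nonempty) : asymmetry C ≠ ∞ := by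
  obtain ⟨c, hc⟩ := hne.intrinsicInterior hconv
  obtain ⟨c', hc', rfl⟩ := mem_intrinsicInterior.1 hc
  obtain ⟨ε, hε, hball⟩ := Metric.isOpen_iff.1 isOpen_interior c' hc'
  have hcC : (c' : E) ∈ C := interior_subset (s := ((↑) : affineSpan ℝ C → E) ⁻¹' C) hc'
  obtain ⟨M, hM, hMC⟩ := hC.subset_closedBall_lt 0 (c' : E)
  set δ := ε / (2 * M)
  have hδ : 0 < δ := by positivity
  have hsub : SubsetTranslate (-C) (δ⁻¹ • C) := by
    refine subsetTranslate_smul_iff.2 ⟨-(c' : E) - δ⁻¹ • (c' : E), fun x hx => ?_⟩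
    have hx' : -x ∈ C := hx
    refine ⟨(c' : E) - δ • (-x - c'), ?_, ?_⟩
    · have hmem : (c' : E) - δ • (-x - c') ∈ affineSpan ℝ C := by
        convert AffineMap.lineMap_mem (-δ) c'.2 (subset_affineSpan ℝ C hx') using 1
        simp only [AffineMap.lineMap_apply, vsub_eq_sub, vadd_eq_add, neg_smul]
        abel
      have hin : (⟨_, hmem⟩ : affineSpan ℝ C) ∈ Metric.ball c' ε → _ := fun h =>
        interior_subset (s := ((↑) : affineSpan ℝ C → E) ⁻¹' C) (hball h)
      refine hin ?_
      rw [Metric.mem_ball, Subtype.dist_eq, dist_eq_norm, sub_sub_cancel_left, norm_neg,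
        norm_smul, Real.norm_of_nonneg hδ.le, ← dist_eq_norm]
      calc δ * dist (-x) (c' : E) ≤ δ * M := by
            gcongr
            exact hMC hx'
        _ = ε / 2 := by
            simp only [δ]
            field_simp
        _ < ε := half_lt_self hε
    · rw [smul_sub, smul_smul, inv_mul_cancel₀ hδ.ne', one_smul]
      abel
  exact ((circumradius_le (inv_pos.2 hδ) hsub).trans_lt ENNReal.ofReal_lt_top).ne

/-- A finite diameter `D(K, C) = d` means `K - K ⊆ (d / 2) (C - C)`. -/
theorem exists_sub_eq_smul_sub {K C : Set E} (hC : IsCompact C) (hconv : Convex ℝ C)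
    {δ : ℝ} (hδ : 0 ≤ δ) (hD : diameter K C = ENNReal.ofReal (2 * δ)) {x y : E} (hx : x ∈ K)
    (hy : y ∈ K) : ∃ a ∈ C, ∃ b ∈ C, x - y = δ • (a - b) := by
  have h1 : 2 * circumradius (segment ℝ x y) C ≤ ENNReal.ofReal (2 * δ) := by
    rw [← hD]
    exact le_iSup₂_of_le x hx (le_iSup₂ (f := fun y _ => segmentLength x y C) y hy)
  rw [ENNReal.ofReal_mul zero_le_two, ENNReal.ofReal_ofNat] at h1
  have h2 := (ENNReal.mul_le_mul_iff_right two_ne_zero ENNReal.ofNat_ne_top).1 h1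
  obtain ⟨ρ, hρ, hρR, hsub⟩ := exists_circumradius_eq ⟨x, left_mem_segment ℝ x y⟩ hC
    (h2.trans_lt ENNReal.ofReal_lt_top).ne
  rw [hρR, ENNReal.ofReal_le_ofReal_iff hδ] at h2
  obtain ⟨c, hc⟩ := subsetTranslate_smul_iff.1 hsub
  obtain ⟨a, ha, hxa⟩ := hc x (left_mem_segment ℝ x y)
  obtain ⟨b, hb, hyb⟩ := hc y (right_mem_segment ℝ x y)
  obtain ⟨a', ha', h⟩ := exists_smul_sub_eq_of_le hconv hρ h2 ha hb
  refine ⟨a', ha', b, hb, ?_⟩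
  rw [← h, hxa, hyb, smul_sub]
  abel

/-- The cancellation argument behind the generalized concentricity inequality. -/
theorem sub_mem_smul_of_concentric {K C : Set E} (hC : IsCompact C) (hconv : Convex ℝ C)
    {s r δ : ℝ} (hs : 0 ≤ s) (hr : 0 ≤ r) (hrδ : r ≤ δ) (hsC : -C ⊆ s • C)
    (hδ : ∀ x ∈ K, ∀ y ∈ K, ∃ a ∈ C, ∃ b ∈ C, x - y = δ • (a - b)) {t : E}
    (ht : ∀ y ∈ C, t + r • y ∈ K) {x : E} (hx : x ∈ K) :
    x - t ∈ (δ + (δ - r) * s) • C := by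
  have hne : C.Nonempty := by
    obtain ⟨a, ha, -⟩ := hδ x hx x hx
    exact ⟨a, ha⟩
  by_contra hnot
  obtain ⟨f, u, hfu, hux⟩ := geometric_hahn_banach_closed_point
    (hconv.smul (δ + (δ - r) * s)) (hC.smul _).isClosed hnot
  -- Cancellation by support functions: the minimizer b of f attains the support value of -C, so
  -- subtracting r f(b) loses nothing.
  obtain ⟨b, hb, hmin⟩ := hC.exists_isMinOn hne f.continuous.continuousOn
  obtain ⟨a, ha, b', hb', hab⟩ := hδ x hx _ (ht b hb)
  obtain ⟨y, hy, hyb⟩ := hsC (show -b ∈ -C by simpa using hb)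
  have hδ0 : 0 ≤ δ := hr.trans hrδ
  have hmem : δ • a + ((δ - r) * s) • y ∈ (δ + (δ - r) * s) • C := by
    rw [hconv.add_smul hδ0 (mul_nonneg (sub_nonneg.2 hrδ) hs)]
    exact Set.add_mem_add (Set.smul_mem_smul_set ha) (Set.smul_mem_smul_set hy)
  have h1 := hfu _ hmem
  have h2 : f b ≤ f b' := hmin hb'
  have h3 := congrArg f hab
  have h4 := congrArg f hyb
  simp only [map_add, map_sub, map_smul, map_neg, smul_eq_mul] at h1 h3 h4 hux
  have h5 : δ * f b ≤ δ * f b' := by gcongr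
  have h6 : (δ - r) * s * f y = (δ - r) * -f b := by rw [← h4]; ring
  linarith

end Normed

/-! ### Comparisons between the radii. -/

section Inequalities

variable {E : Type*} [NormedAddCommGroup E] [NormedSpace ℝ E] {K C : Set E}

theorem le_of_circumradius_eq (hK : K.Nontrivial) {R ρ : ℝ}
    (hR : circumradius K C = ENNReal.ofReal R) (hρ : 0 ≤ ρ) (h : SubsetTranslate K (ρ • C)) :
    R ≤ ρ := by
  have := circumradius_le (pos_of_subsetTranslate_smul hK hρ h) h
  rwa [hR, ENNReal.ofReal_le_ofReal_iff hρ] at this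

/-- For r > 0, -K ⊂ₜ R(-C) ⊂ₜ (R/r)K. -/
theorem asymmetry_mul_inradius_neg_le (hK : K.Nontrivial) {sK r R : ℝ}
    (hsK : asymmetry K = ENNReal.ofReal sK) (hr : 0 ≤ r) (hR : 0 ≤ R)
    (hrK : SubsetTranslate (r • (-C)) K) (hRK : SubsetTranslate K (R • C)) : sK * r ≤ R := by
  rcases hr.eq_or_lt with rfl | hr
  · simpa using hR
  rw [← le_div_iff₀ hr]
  obtain ⟨c, hc⟩ := subsetTranslate_smul_iff.1 hRK
  obtain ⟨c', hc'⟩ := smul_subsetTranslate_iff.1 hrK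
  refine le_of_circumradius_eq (nontrivial_neg hK) hsK (by positivity)
    (subsetTranslate_smul_iff.2 ⟨-c - (R / r) • c', fun x hx => ?_⟩)
  obtain ⟨y, hy, hxy⟩ := hc (-x) hx
  refine ⟨_, hc' (-y) (by simpa using hy), ?_⟩
  rw [← neg_neg x, hxy, smul_add, smul_smul, div_mul_cancel₀ _ hr.ne', smul_neg]
  abel

/-- C ⊂ₜ s(-C) gives (r'/s)C ⊂ₜ r'(-C) ⊂ₜ K. -/
theorem inradius_neg_le_asymmetry_mul {s r r' : ℝ} (hs : 0 < s)
    (hsC : SubsetTranslate (-C) (s • C)) (hr : 0 ≤ r) (hrK : inradius K C = ENNReal.ofReal r)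
    (hr' : 0 ≤ r') (hrK' : SubsetTranslate (r' • (-C)) K) : r' ≤ s * r := by
  obtain ⟨c, hc⟩ := subsetTranslate_smul_iff.1 hsC
  obtain ⟨c', hc'⟩ := smul_subsetTranslate_iff.1 hrK'
  have : ENNReal.ofReal (r' / s) ≤ inradius K C := by
    refine le_inradius (by positivity) (smul_subsetTranslate_iff.2
      ⟨c' + (r' / s) • c, fun x hx => ?_⟩)
    obtain ⟨y, hy, hxy⟩ := hc (-x) (by simpa using hx)
    convert hc' (-y) (by simpa using hy) using 1
    rw [← neg_neg x, hxy, smul_neg, smul_add, smul_smul, div_mul_cancel₀ _ hs.ne', smul_neg]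
    abel
  rw [hrK, ENNReal.ofReal_le_ofReal_iff hr, div_le_iff₀ hs] at this
  linarith

/-- `(1 + 1 / s(K)) K ⊂ₜ K - K ⊆ δ (C - C) ⊂ₜ δ (1 + s(C)) C`. -/
theorem subsetTranslate_smul_of_sub (hconv : Convex ℝ C) {s sK δ : ℝ} (hs : 0 ≤ s)
    (hsC : SubsetTranslate (-C) (s • C)) (hsK : 0 < sK) (hsKK : SubsetTranslate (-K) (sK • K))
    (hsub : ∀ x ∈ K, ∀ y ∈ K, ∃ a ∈ C, ∃ b ∈ C, x - y = δ • (a - b)) :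
    SubsetTranslate K ((sK / (1 + sK) * (δ * (1 + s))) • C) := by
  obtain ⟨c, hc⟩ := subsetTranslate_smul_iff.1 hsKK
  obtain ⟨d, hd⟩ := subsetTranslate_smul_iff.1 hsC
  set q := sK / (1 + sK) with hq
  refine subsetTranslate_smul_iff.2 ⟨q • (δ • d) - (1 + sK)⁻¹ • c, fun x hx => ?_⟩
  obtain ⟨k, hk, hxk⟩ := hc (-x) (by simpa using hx)
  obtain ⟨a, ha, b, hb, hab⟩ := hsub x hx k hk
  obtain ⟨y, hy, hby⟩ := hd (-b) (by simpa using hb)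
  have hmem : (1 : ℝ) • a + s • y ∈ (1 + s) • C := by
    rw [hconv.add_smul zero_le_one hs]
    exact Set.add_mem_add (Set.smul_mem_smul_set ha) (Set.smul_mem_smul_set hy)
  obtain ⟨z, hz, hzy⟩ := hmem
  refine ⟨z, hz, ?_⟩
  -- Solve -x = c + sK k for x in terms of x - k.
  have hx' : x = q • (x - k) - (1 + sK)⁻¹ • c := by
    have hc' : c = -x - sK • k := by rw [hxk]; abel
    have h1 : 1 + sK ≠ 0 := by positivity
    rw [hc', hq]
    match_scalars <;> field_simp <;> ring
  have hz' : (1 + s) • z = a + s • y := by simpa using hzy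
  rw [mul_smul, mul_smul, hz']
  have hab' : x - k = δ • (d + (a + s • y)) := by
    rw [hab, sub_eq_add_neg, hby]
    congr 1
    abel
  rw [hab'] at hx'
  rw [hx', smul_add δ, smul_add q]
  abel

/-- With the origin of `C` at a Minkowski center, a translate of `r C` inside `K` is concentric
with a translate of `(δ + (δ - r) s) C` containing `K`. -/
theorem exists_concentric (hC : IsCompact C) (hconv : Convex ℝ C) {s r δ : ℝ} (hs : 0 ≤ s)
    (hr : 0 ≤ r) (hrδ : r ≤ δ) (hsC : SubsetTranslate (-C) (s • C))
    (hrK : SubsetTranslate (r • C) K)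
    (hsub : ∀ x ∈ K, ∀ y ∈ K, ∃ a ∈ C, ∃ b ∈ C, x - y = δ • (a - b)) :
    ∃ c t : E, -((-c) +ᵥ C) ⊆ s • ((-c) +ᵥ C) ∧ r • ((-c) +ᵥ C) ⊆ (-t) +ᵥ K ∧
      (-t) +ᵥ K ⊆ (δ + (δ - r) * s) • ((-c) +ᵥ C) := by
  obtain ⟨c, hc⟩ := exists_center hs hsC
  obtain ⟨c', hc'⟩ := smul_subsetTranslate_iff.1 hrK
  have ht : ∀ y ∈ (-c) +ᵥ C, c' + r • c + r • y ∈ K := by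
    rintro _ ⟨y, hy, rfl⟩
    convert hc' y hy using 1
    simp only [vadd_eq_add, smul_add, smul_neg]
    abel
  -- Recentering: c' + rC = (c' + r c) + r(C - c).
  refine ⟨c, c' + r • c, hc, ?_, ?_⟩
  · rintro _ ⟨y, hy, rfl⟩
    exact ⟨_, ht y hy, by simp only [vadd_eq_add]; abel⟩
  · rintro _ ⟨x, hx, rfl⟩
    have hsub' : ∀ x ∈ K, ∀ y ∈ K, ∃ a ∈ (-c) +ᵥ C, ∃ b ∈ (-c) +ᵥ C, x - y = δ • (a - b) := by
      intro x hx y hy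
      obtain ⟨a, ha, b, hb, hab⟩ := hsub x hx y hy
      exact ⟨_, ⟨a, ha, rfl⟩, _, ⟨b, hb, rfl⟩, by simpa using hab⟩
    have := sub_mem_smul_of_concentric (hC.vadd (-c)) (hconv.vadd (-c)) hs hr hrδ hc hsub' ht hx
    simpa [sub_eq_neg_add] using this

theorem SubsetTranslate.smul_of_vadd {ρ : ℝ} {c t : E}
    (h : (-t) +ᵥ K ⊆ ρ • ((-c) +ᵥ C)) : SubsetTranslate K (ρ • C) := by
  refine subsetTranslate_smul_iff.2 ⟨t - ρ • c, fun x hx => ?_⟩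
  obtain ⟨_, ⟨y, hy, rfl⟩, hxy⟩ := h ⟨x, hx, rfl⟩
  refine ⟨y, hy, ?_⟩
  have hx' : x = t + (-t + x) := by abel
  simp only [vadd_eq_add, smul_add, smul_neg] at hxy
  rw [hx', ← hxy]
  abel

end Inequalities

end MinkowskiRadii

/-! ### Passage from real inequalities to [0,∞]. -/

theorem theorem1 (n : ℕ) (K C : Set (EuclideanSpace ℝ (Fin n)))
    (hK_convex : Convex ℝ K) (hK_compact : IsCompact K) (hK_nontrivial : K.Nontrivial)
    (hC_convex : Convex ℝ C) (hC_compact : IsCompact C) (hC_nontrivial : C.Nontrivial) :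
    -- first chain
    ((1 + asymmetry K) * inradius K (-C) ≤ inradius K (-C) + circumradius K C ∧
      inradius K (-C) + circumradius K C ≤ asymmetry C * inradius K C + circumradius K C ∧
      asymmetry C * inradius K C + circumradius K C ≤
        1 / 2 * (1 + asymmetry C) * diameter K C) ∧
    -- second chain
    ((1 + asymmetry K) * inradius K (-C) ≤ inradius K (-C) + circumradius K C ∧
      inradius K (-C) + circumradius K C ≤
        (1 + asymmetry K) / asymmetry K * circumradius K C ∧
      (1 + asymmetry K) / asymmetry K * circumradius K C ≤
        1 / 2 * (1 + asymmetry C) * diameter K C) ∧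
    -- equality (of finite quantities) in the generalized concentricity inequality
    (circumradius K C ≠ ∞ →
      asymmetry C * inradius K C + circumradius K C =
        1 / 2 * (1 + asymmetry C) * diameter K C →
      IsMinkowskiConcentric K C) := by
  have hsC_top := asymmetry_ne_top hC_convex hC_compact.isBounded hC_nontrivial.nonempty
  have hsK_top := asymmetry_ne_top hK_convex hK_compact.isBounded hK_nontrivial.nonempty
  obtain ⟨s, hs, hsC, hsC'⟩ :=
    exists_circumradius_eq hC_nontrivial.nonempty.neg hC_compact hsC_top
  obtain ⟨sK, hsK, hsKK, hsKK'⟩ :=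
    exists_circumradius_eq hK_nontrivial.nonempty.neg hK_compact hsK_top
  replace hs := pos_of_subsetTranslate_smul (nontrivial_neg hC_nontrivial) hs hsC'
  replace hsK := pos_of_subsetTranslate_smul (nontrivial_neg hK_nontrivial) hsK hsKK'
  obtain ⟨r, hr, hrK, hrK'⟩ := exists_inradius_eq hK_compact hK_nontrivial.nonempty
    hC_compact.isBounded hC_nontrivial
  obtain ⟨q, hq, hqK, hqK'⟩ := exists_inradius_eq hK_compact hK_nontrivial.nonempty
    hC_compact.neg.isBounded (nontrivial_neg hC_nontrivial)
  have hsC₁ : asymmetry C = ENNReal.ofReal s := hsC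
  have hsK₁ : asymmetry K = ENNReal.ofReal sK := hsKK
  have hone : (1 : ℝ≥0∞) = ENNReal.ofReal 1 := ENNReal.ofReal_one.symm
  have hquot : (1 + asymmetry K) / asymmetry K = ENNReal.ofReal ((1 + sK) / sK) := by
    rw [hsK₁, hone, ← ENNReal.ofReal_add zero_le_one hsK.le, ENNReal.ofReal_div_of_pos hsK]
  have hhalf : 1 / 2 * (1 + asymmetry C) = ENNReal.ofReal ((1 + s) / 2) := by
    rw [hsC₁, ENNReal.ofReal_div_of_pos two_pos, ENNReal.ofReal_add zero_le_one hs.le,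
      ENNReal.ofReal_one, ENNReal.ofReal_ofNat, ENNReal.div_eq_inv_mul,
      ENNReal.div_eq_inv_mul, mul_one]
  have hneg : (1 + asymmetry K) * inradius K (-C) = ENNReal.ofReal ((1 + sK) * q) := by
    rw [hsK₁, hqK, hone, ← ENNReal.ofReal_add zero_le_one hsK.le,
      ← ENNReal.ofReal_mul (by positivity)]
  have hin : asymmetry C * inradius K C = ENNReal.ofReal (s * r) := by
    rw [hsC₁, hrK, ← ENNReal.ofReal_mul hs.le]
  have hhalf_pos : ENNReal.ofReal ((1 + s) / 2) ≠ 0 := by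
    simp only [ne_eq, ENNReal.ofReal_eq_zero, not_le]
    positivity
  have hquot_pos : ENNReal.ofReal ((1 + sK) / sK) ≠ 0 := by
    simp only [ne_eq, ENNReal.ofReal_eq_zero, not_le]
    positivity
  have hqr := inradius_neg_le_asymmetry_mul hs hsC' hr hrK hq hqK'
  -- the inequalities that involve the diameter
  have hdiam : ∀ δ : ℝ, 0 ≤ δ → diameter K C = ENNReal.ofReal (2 * δ) →
      ∃ R : ℝ, 0 ≤ R ∧ circumradius K C = ENNReal.ofReal R ∧
        s * r + R ≤ (1 + s) * δ ∧ (1 + sK) / sK * R ≤ (1 + s) * δ ∧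
        (s * r + R = (1 + s) * δ → IsMinkowskiConcentric K C) := by
    intro δ hδ hD
    have hsub : ∀ x ∈ K, ∀ y ∈ K, ∃ a ∈ C, ∃ b ∈ C, x - y = δ • (a - b) := fun x hx y hy =>
      exists_sub_eq_smul_sub hC_compact hC_convex hδ hD hx hy
    -- r(C - C) ⊆ K - K ⊆ δ(C - C).
    have hrδ : r ≤ δ := by
      obtain ⟨c, hc⟩ := smul_subsetTranslate_iff.1 hrK'
      refine le_of_smul_sub_smul_mem hC_compact.isBounded hC_nontrivial hδ fun a ha b hb => ?_
      obtain ⟨x, hx, y, hy, hxy⟩ := hsub _ (hc a ha) _ (hc b hb)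
      exact ⟨x, hx, y, hy, by rw [← hxy, smul_sub]; abel⟩
    obtain ⟨c, t, hc, hrt, hRt⟩ := exists_concentric hC_compact hC_convex hs.le hr hrδ hsC' hrK' hsub
    have hout := SubsetTranslate.smul_of_vadd hRt
    have hout_nonneg : 0 ≤ δ + (δ - r) * s := by
      have := sub_nonneg.2 hrδ
      positivity
    have hR_top : circumradius K C ≠ ∞ :=
      ((circumradius_le (pos_of_subsetTranslate_smul hK_nontrivial hout_nonneg hout)
        hout).trans_lt ENNReal.ofReal_lt_top).ne
    obtain ⟨R, hR, hRK, -⟩ := exists_circumradius_eq hK_nontrivial.nonempty hC_compact hR_top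
    refine ⟨R, hR, hRK, ?_, ?_, fun heq => ?_⟩
    · linarith [le_of_circumradius_eq hK_nontrivial hRK hout_nonneg hout]
    · have := le_of_circumradius_eq hK_nontrivial hRK (by positivity)
        (subsetTranslate_smul_of_sub hC_convex hs.le hsC' hsK hsKK' hsub)
      calc (1 + sK) / sK * R ≤ (1 + sK) / sK * (sK / (1 + sK) * (δ * (1 + s))) := by gcongr
        _ = (1 + s) * δ := by field_simp
    -- Equality makes the outer factor δ + (δ - r)s exactly R.
    · refine ⟨by simp [hrK], hR_top, c, t, ⟨hsC_top, ?_⟩, ?_, ?_⟩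
      · rwa [hsC₁, ENNReal.toReal_ofReal hs.le]
      · rwa [hrK, ENNReal.toReal_ofReal hr]
      · rw [hRK, ENNReal.toReal_ofReal hR]
        rwa [show R = δ + (δ - r) * s by linarith]
  have hdiam_real : ∀ δ : ℝ, 0 ≤ δ → diameter K C = ENNReal.ofReal (2 * δ) →
      1 / 2 * (1 + asymmetry C) * diameter K C = ENNReal.ofReal ((1 + s) * δ) := by
    intro δ hδ hD
    rw [hhalf, hD, ← ENNReal.ofReal_mul (by positivity)]
    congr 1
    ring
  have hdiam_cases : diameter K C = ∞ ∨
      ∃ δ : ℝ, 0 ≤ δ ∧ diameter K C = ENNReal.ofReal (2 * δ) := by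
    refine or_iff_not_imp_left.2 fun h => ⟨(diameter K C).toReal / 2, by positivity, ?_⟩
    rw [mul_div_cancel₀ _ two_ne_zero, ENNReal.ofReal_toReal h]
  have hfirst : (1 + asymmetry K) * inradius K (-C) ≤ inradius K (-C) + circumradius K C := by
    by_cases hR_top : circumradius K C = ∞
    · simp [hR_top]
    obtain ⟨R, hR, hRK, hRK'⟩ := exists_circumradius_eq hK_nontrivial.nonempty hC_compact hR_top
    rw [hneg, hqK, hRK, ← ENNReal.ofReal_add hq hR]
    refine ENNReal.ofReal_le_ofReal ?_
    linarith [asymmetry_mul_inradius_neg_le hK_nontrivial hsK₁ hq hR hqK' hRK']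
  refine ⟨⟨hfirst, ?_, ?_⟩, ⟨hfirst, ?_, ?_⟩, fun hR_top heq => ?_⟩
  · rw [hin, hqK]
    gcongr
  · rcases hdiam_cases with hD | ⟨δ, hδ, hD⟩
    · rw [hhalf, hD, ENNReal.mul_top hhalf_pos]
      exact le_top
    · obtain ⟨R, hR, hRK, h, -, -⟩ := hdiam δ hδ hD
      rw [hdiam_real δ hδ hD, hin, hRK, ← ENNReal.ofReal_add (by positivity) hR]
      exact ENNReal.ofReal_le_ofReal h
  · by_cases hR_top : circumradius K C = ∞
    · rw [hquot, hR_top, ENNReal.mul_top hquot_pos]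
      exact le_top
    obtain ⟨R, hR, hRK, hRK'⟩ := exists_circumradius_eq hK_nontrivial.nonempty hC_compact hR_top
    rw [hquot, hqK, hRK, ← ENNReal.ofReal_add hq hR, ← ENNReal.ofReal_mul (by positivity)]
    refine ENNReal.ofReal_le_ofReal ?_
    have h := asymmetry_mul_inradius_neg_le hK_nontrivial hsK₁ hq hR hqK' hRK'
    rw [div_mul_eq_mul_div, le_div_iff₀ hsK]
    linarith
  · rcases hdiam_cases with hD | ⟨δ, hδ, hD⟩
    · rw [hhalf, hD, ENNReal.mul_top hhalf_pos]
      exact le_top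
    · obtain ⟨R, hR, hRK, -, h, -⟩ := hdiam δ hδ hD
      rw [hdiam_real δ hδ hD, hquot, hRK, ← ENNReal.ofReal_mul (by positivity)]
      exact ENNReal.ofReal_le_ofReal h
  · rcases hdiam_cases with hD | ⟨δ, hδ, hD⟩
    -- Infinite D is incompatible with equality, since the left side is finite.
    · rw [hhalf, hD, ENNReal.mul_top hhalf_pos, hin] at heq
      exact absurd heq (ENNReal.add_ne_top.2 ⟨ENNReal.ofReal_ne_top, hR_top⟩)
    · obtain ⟨R, hR, hRK, -, -, h⟩ := hdiam δ hδ hD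
      rw [hdiam_real δ hδ hD, hin, hRK, ← ENNReal.ofReal_add (by positivity) hR,
        ENNReal.ofReal_eq_ofReal_iff (by positivity) (by positivity)] at heq
      exact h heq
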